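/- Let $n\ge 1$, let $A=\{a_1,\dots,a_n\}$, let $W(A)$ be the free monoid on $A$, and let $\star$ be the empty word. \emph{Words.} For $I\subseteq A$ and $w\in W(A)$, let $T_Iw$ be the longest suffix of $w$ whose first letter lies in $I$ (and $T_Iw=\star$ if no letter of $I$ occurs in $w$), and write $T_i=T_{\{a_i\}}$ and $T_{\{1,\dots,k\}}=T_{\{a_1,\dots,a_k\}}$. A quasi-subword of $w$ is a word obtained from $w$ by deleting some (possibly no) letters. The join of $u,v\in W(A)$ is $[u,v]=u^+v$, where $u=u^+u^-$ and $u^-$ is the longest suffix of $u$ that is a quasi-subword of $v$. \emph{Canonical forms.} Kiselman's semigroup is the monoid $$\mathrm K_n=\langle a_1,\dots,a_n \mid a_i^2=a_i \text{ for all } i;\ a_ia_ja_i=a_ja_ia_j=a_ia_j \text{ for } i<j\rangle,$$ with canonical projection $\pi\colon W(A)\to \mathrm K_n$. A word is canonical if every subword (string of consecutive letters) of it of the form $a_iua_i$ is such that $u$ contains both some $a_j$ with $j>i$ and some $a_k$ with $k<i$. Denote by $\mathrm{Can}\,w$ the canonical word in $\pi^{-1}\pi(w)$ (its existence and uniqueness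 is part (0) below), and by $\mathrm{Can}_{\{i,\dots,n\}}w$ the canonical form of the word obtained from $w$ by deleting all the letters $a_1,\dots,a_{i-1}$. \emph{The update system $\mathcal S_n^\star$.} The vertices are $1,\dots,n$, with an arrow $i\to j$ if and only if $i<j$. The finite state sets $S_i\subset W(A)$ are defined for $i=n,n-1,\dots,1$ by $$S_n=\{\star,a_n\},\qquad S_{n-1}=\{\star,a_{n-1},a_{n-1}a_n\},\qquad S_i=\{\star\}\cup a_i[S_n,[\dots,[S_{i+2},S_{i+1}]\dots]]\quad (i\le n-2),$$ where $[U,V]=\{[u,v] : u\in U, v\in V\}$. The vertex functions are $f_n\equiv a_n$, $f_{n-1}(s_n)=a_{n-1}s_n$, and $$f_i(s_{i+1},\dots,s_n)=a_i[s_n,[\dots,[s_{i+2},s_{i+1}]\dots]]\quad (i\le n-2).$$ Let $F_i\colon S\to S$, $S=\prod_i S_i$, be the map that replaces the $i$-th coordinate $s_i$ of $\mathbf s$ by $f_i(s_{i+1},\dots,s_n)$ and fixes all the other coordinates; for $w=a_{i_1}\cdots a_{i_m}$ let $F_w=F_{i_1}\circ\dots\circ F_{i_m}$ (the identity if $w=\star$).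 Denote also by $\star$ the system state $(\star,\dots,\star)\in S$. \textbf{Proposition.} Let $w\in W(A)$ and let $\mathbf p=(p_1,\dots,p_n)=F_w(\star)$. Then: (0) the fibre $\pi^{-1}\pi(w)$ contains exactly one canonical word, so that $\mathrm{Can}\,w$ is well defined; (i) for every $1\le i\le n$, $p_i=\mathrm{Can}_{\{i,\dots,n\}}T_iw$; (ii) for every $1\le k\le n$ there is $j$ with $1\le j\le k$ such that $$[p_k,[\dots,[p_2,p_1]\dots]]=T_{\{1,\dots,k\}}\mathrm{Can}\,w=T_j\,\mathrm{Can}\,w$$ (for $k=1$ the left-hand side is $p_1$). -/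

import Mathlib

namespace Kiselman

/-! ### Update systems over a directed graph -/

/-- An update system: a base graph, a finite set of states on each vertex, and for each vertex `i`
a vertex function computing a new state from the states of the vertices `j` with `i → j`. -/
structure UpdateSystem (V : Type) where
  graph : Digraph V
  State : V → Type
  finite_state : ∀ i, Finite (State i)
  vertexFun : ∀ i, ((j : {j : V // graph.Adj i j}) → State j) → State i

namespace UpdateSystem

variable {V : Type} [DecidableEq V] (S : UpdateSystem V)

/-- System states. -/
abbrev SystemState {V : Type} (S : UpdateSystem V) : Type := (i : V) → S.State i

/-- The local function `F_i`: it replaces the state of `i` by the value of the vertex function. -/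
def localMap (i : V) (s : S.SystemState) : S.SystemState :=
  Function.update s i (S.vertexFun i fun j => s j)

/-- The evaluation morphism `w = i₁ i₂ … i_k ↦ F_w = F_{i₁} ∘ F_{i₂} ∘ ⋯ ∘ F_{i_k}`
(the product of `Function.End` is composition). -/
def eval : FreeMonoid V →* Function.End S.SystemState :=
  FreeMonoid.lift fun i => (S.localMap i : Function.End S.SystemState)

end UpdateSystem

/-! ### Words -/

/-- Words over the alphabet `a₁, …, a_n`; the letter `a_{i+1}` is `i : Fin n`, the empty word
is `[]`. -/
abbrev Word (n : ℕ) : Type := List (Fin n)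

/-- The truncation `T_I w`: the longest suffix of `w` whose head lies in `I`, or the empty word
if no letter of `I` occurs in `w`. -/
def trunc {n : ℕ} (I : Finset (Fin n)) (w : Word n) : Word n :=
  w.dropWhile fun a => a ∉ I

/-- The deletion morphism, erasing all the letters that lie in `I`. -/
def del {n : ℕ} (I : Finset (Fin n)) (w : Word n) : Word n :=
  w.filter fun a => a ∉ I

/-- The join `[u, v] = u⁺ v`, where `u = u⁺ u⁻` and `u⁻` is the longest suffix of `u` that is a
quasi-subword (`List.Sublist`) of `v`. -/
def join {n : ℕ} : Word n → Word n → Word n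
  | [], v => v
  | a :: u, v => if (a :: u).Sublist v then v else a :: join u v

/-- The defining property of the join. -/
theorem join_spec {n : ℕ} (u v : Word n) :
    ∃ up um : Word n, u = up ++ um ∧ um.Sublist v ∧
      (∀ t : Word n, t <:+ u → t.Sublist v → t <:+ um) ∧ join u v = up ++ v := by
  induction u with
  | nil => exact ⟨[], [], rfl, List.nil_sublist v, fun t ht _ => ht, rfl⟩
  | cons a u ih =>
    by_cases h : (a :: u).Sublist v
    · exact ⟨[], a :: u, rfl, h, fun t ht _ => ht, by simp [join, h]⟩
    · obtain ⟨up, um, hu, hs, hmax, hj⟩ := ih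
      refine ⟨a :: up, um, by simp [hu], hs, fun t ht hts => ?_, by simp [join, h, hj]⟩
      rcases List.suffix_cons_iff.1 ht with rfl | ht
      · exact absurd hts h
      · exact hmax t ht hts

/-- The iterated join `[w_k, [… , [w_2, w_1] …]]` of a list of words `w_1, w_2, …, w_k`
(the empty word for the empty list, and `w_1` for a list of length one). -/
def iterJoin {n : ℕ} (l : List (Word n)) : Word n :=
  l.foldl (fun acc u => join u acc) []

theorem join_nil {n : ℕ} (u : Word n) : join u [] = u := by
  induction u with
  | nil => rfl
  | cons a u ih => simp [join, ih]

theorem iterJoin_nil {n : ℕ} : iterJoin ([] : List (Word n)) = [] := rfl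

theorem iterJoin_singleton {n : ℕ} (u : Word n) : iterJoin [u] = u := join_nil u

theorem iterJoin_concat {n : ℕ} (l : List (Word n)) (u : Word n) :
    iterJoin (l ++ [u]) = join u (iterJoin l) := by
  simp [iterJoin]

/-! ### Kiselman's semigroup and canonical words -/

/-- The defining relations of Kiselman's semigroup. -/
inductive Rel (n : ℕ) : FreeMonoid (Fin n) → FreeMonoid (Fin n) → Prop
  | idem (i : Fin n) :
      Rel n (FreeMonoid.of i * FreeMonoid.of i) (FreeMonoid.of i)
  | left (i j : Fin n) (h : i < j) :
      Rel n (FreeMonoid.of i * FreeMonoid.of j * FreeMonoid.of i)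
        (FreeMonoid.of i * FreeMonoid.of j)
  | right (i j : Fin n) (h : i < j) :
      Rel n (FreeMonoid.of j * FreeMonoid.of i * FreeMonoid.of j)
        (FreeMonoid.of i * FreeMonoid.of j)

/-- Kiselman's semigroup `K_n`. -/
abbrev K (n : ℕ) : Type := PresentedMonoid (Rel n)

/-- The canonical evaluation of words in `K_n`. -/
def proj {n : ℕ} (w : Word n) : K n := PresentedMonoid.mk (Rel n) (FreeMonoid.ofList w)

/-- A word is canonical if each subword (factor) of the form `a u a` is special, that is, `u`
contains both a letter of index larger, and a letter of index smaller, than that of `a`. -/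
def IsCanonical {n : ℕ} (w : Word n) : Prop :=
  ∀ (a : Fin n) (u : Word n), a :: (u ++ [a]) <:+: w → (∃ j ∈ u, a < j) ∧ (∃ k ∈ u, k < a)

theorem proj_append {n : ℕ} (u v : Word n) : proj (u ++ v) = proj u * proj v := by
  simp [proj, FreeMonoid.ofList_append]

theorem proj_cons {n : ℕ} (a : Fin n) (v : Word n) : proj (a :: v) = proj [a] * proj v :=
  proj_append [a] v

theorem proj_idem {n : ℕ} (i : Fin n) : proj [i] * proj [i] = proj [i] :=
  PresentedMonoid.mk_eq_mk_of_rel (Rel.idem i)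

theorem proj_left {n : ℕ} {i j : Fin n} (h : i < j) :
    proj [i] * proj [j] * proj [i] = proj [i] * proj [j] :=
  PresentedMonoid.mk_eq_mk_of_rel (Rel.left i j h)

theorem proj_right {n : ℕ} {i j : Fin n} (h : i < j) :
    proj [j] * proj [i] * proj [j] = proj [i] * proj [j] :=
  PresentedMonoid.mk_eq_mk_of_rel (Rel.right i j h)

theorem proj_cancel_right {n : ℕ} (a : Fin n) (u : Word n) (h : ∀ j ∈ u, a ≤ j) :
    proj [a] * proj u * proj [a] = proj [a] * proj u := by
  induction u using List.reverseRecOn with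
  | nil => simpa [proj] using proj_idem a
  | append_singleton u c ih =>
    have ih := ih fun j hj => h j (by simp [hj])
    have hc : proj [a] * proj [c] * proj [a] = proj [a] * proj [c] := by
      rcases (h c (by simp)).eq_or_lt with rfl | hlt
      · rw [proj_idem, proj_idem]
      · exact proj_left hlt
    calc proj [a] * proj (u ++ [c]) * proj [a]
        = proj [a] * proj u * proj [c] * proj [a] := by rw [proj_append]; simp only [mul_assoc]
      _ = proj [a] * proj u * proj [a] * proj [c] * proj [a] := by rw [ih]
      _ = proj [a] * proj u * (proj [a] * proj [c] * proj [a]) := by simp only [mul_assoc]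
      _ = proj [a] * proj u * proj [a] * proj [c] := by rw [hc]; simp only [mul_assoc]
      _ = proj [a] * proj (u ++ [c]) := by rw [ih, proj_append]; simp only [mul_assoc]

theorem proj_cancel_left {n : ℕ} (a : Fin n) (u : Word n) (h : ∀ j ∈ u, j ≤ a) :
    proj [a] * proj u * proj [a] = proj u * proj [a] := by
  induction u with
  | nil => simpa [proj] using proj_idem a
  | cons c u ih =>
    have ih := ih fun j hj => h j (by simp [hj])
    have hc : proj [a] * proj [c] * proj [a] = proj [c] * proj [a] := by
      rcases (h c (by simp)).eq_or_lt with rfl | hlt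
      · rw [proj_idem, proj_idem]
      · exact proj_right hlt
    calc proj [a] * proj (c :: u) * proj [a]
        = proj [a] * proj [c] * (proj u * proj [a]) := by rw [proj_cons c u]; simp only [mul_assoc]
      _ = proj [a] * proj [c] * proj [a] * (proj u * proj [a]) := by
          rw [mul_assoc (proj [a] * proj [c]), ← mul_assoc (proj [a]) (proj u), ih]
      _ = proj [c] * (proj [a] * proj u * proj [a]) := by rw [hc]; simp only [mul_assoc]
      _ = proj (c :: u) * proj [a] := by rw [ih, proj_cons c u]; simp only [mul_assoc]

/-- Each fibre of the evaluation in `K_n` contains a canonical word. -/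
theorem exists_canonical {n : ℕ} (w : Word n) : ∃ v : Word n, proj v = proj w ∧ IsCanonical v := by
  classical
  have hex : ∃ m : ℕ, ∃ v : Word n, proj v = proj w ∧ v.length = m := ⟨_, w, rfl, rfl⟩
  obtain ⟨v, hv, hlen⟩ := Nat.find_spec hex
  have hmin : ∀ v' : Word n, proj v' = proj w → v.length ≤ v'.length := fun v' h' =>
    hlen ▸ Nat.find_min' hex ⟨v', h', rfl⟩
  refine ⟨v, hv, ?_⟩
  rintro a u ⟨x, y, rfl⟩
  constructor
  · by_contra hcon
    push Not at hcon
    have hp : proj (x ++ (u ++ [a]) ++ y) = proj w := by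
      rw [← hv]
      simp only [proj_append, proj_cons a (u ++ [a])]
      rw [← mul_assoc (proj [a]) (proj u), proj_cancel_left a u hcon]
    have := hmin _ hp
    simp at this
  · by_contra hcon
    push Not at hcon
    have hp : proj (x ++ (a :: u) ++ y) = proj w := by
      rw [← hv]
      simp only [proj_append, proj_cons a (u ++ [a]), proj_cons a u]
      rw [← mul_assoc (proj [a]) (proj u), proj_cancel_right a u hcon]
    have := hmin _ hp
    simp at this

/-- The canonical form of `w`: the canonical word that has the same class as `w` in `K_n`. -/
noncomputable def can {n : ℕ} (w : Word n) : Word n := (exists_canonical w).choose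

/-- `Can_I w`: the canonical form of the word obtained from `w` by deleting all letters outside
`I`. -/
noncomputable def canOn {n : ℕ} (I : Finset (Fin n)) (w : Word n) : Word n := can (del Iᶜ w)

/-! ### The universal update system -/

/-- The complete oriented graph: `i → j` if and only if `i < j`. -/
def completeOriented (n : ℕ) : Digraph (Fin n) where
  Adj i j := i < j

/-- Given words `s_j` for the neighbours `j` of `i`, that is, for `j > i`, the word
`a_i [s_n, [… , [s_{i+2}, s_{i+1}] …]]`. -/
def updateWord {n : ℕ} (i : Fin n) (s : {j : Fin n // (completeOriented n).Adj i j} → Word n) :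
    Word n :=
  i :: iterJoin ((List.finRange n).filterMap fun j => if h : i < j then some (s ⟨j, h⟩) else none)

/-- The state sets `S_i = {⋆} ∪ a_i [S_n, [… , [S_{i+2}, S_{i+1}] …]]`, where `[U, V]` is the set
of all joins `[u, v]`, `u ∈ U`, `v ∈ V`. For the last two vertices they are `{⋆, a_n}` and
`{⋆, a_{n-1}, a_{n-1} a_n}`. -/
inductive IsState {n : ℕ} : Fin n → Word n → Prop
  | empty (i : Fin n) : IsState i []
  | update (i : Fin n) (s : {j : Fin n // (completeOriented n).Adj i j} → Word n)
      (hs : ∀ j, IsState j.1 (s j)) : IsState i (updateWord i s)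

theorem finite_isState {n : ℕ} (i : Fin n) : Finite {w : Word n // IsState i w} := by
  induction i using WellFoundedGT.induction with
  | ind i ih =>
    have : ∀ j : {j : Fin n // (completeOriented n).Adj i j}, Finite {w : Word n // IsState j.1 w} :=
      fun j => ih j.1 j.2
    refine Set.Finite.subset (s := insert [] (Set.range fun
      (s : (j : {j : Fin n // (completeOriented n).Adj i j}) → {w : Word n // IsState j.1 w}) =>
        updateWord i fun j => (s j).1)) ((Set.finite_range _).insert _) ?_
    rintro w hw
    cases hw with
    | empty => exact Set.mem_insert _ _
    | update _ s hs => exact Set.mem_insert_of_mem _ ⟨fun j => ⟨s j, hs j⟩, rfl⟩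

/-- The update system `S_n^⋆`. -/
def starSystem (n : ℕ) : UpdateSystem (Fin n) where
  graph := completeOriented n
  State i := {w : Word n // IsState i w}
  finite_state := finite_isState
  vertexFun i s := ⟨updateWord i fun j => (s j).1, IsState.update i _ fun j => (s j).2⟩

/-- The system state `⋆ = (⋆, …, ⋆)`. -/
def starState (n : ℕ) : (starSystem n).SystemState := fun i => ⟨[], IsState.empty i⟩

/-- The state `p_i`, as a word, on vertex `i` of the system state `p = F_w ⋆`. -/
def stateAt {n : ℕ} (w : Word n) (i : Fin n) : Word n :=
  ((starSystem n).eval (FreeMonoid.ofList w) (starState n) i).1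

end Kiselman

namespace Kiselman

/-! ### Factors, deletions and truncations -/

/-! For each letter `d`, the class of what follows the first `d` in a word, with the letters `≤ d`
erased, depends only on the class of the word (`tail_invariants`). `vertexWord d w` stores this
invariant as a word.

The core is that a canonical word is rebuilt from its vertex words by iterated joins: joining the
vertex word of `k` onto the truncation at letters `< k` gives the truncation at letters `≤ k`
(`IsCanonical.trunc_Iic`). In the main case these truncations are `A` and `k y A`, and the vertex
word is `k y z` with `z` a quasi-subword of `A` (`exists_canonical_append`). The join cuts exactly
in front of `z` by `le_of_proj_del_eq`.

Hence canonical words of the same class coincide. The reconstruction itself needs this uniqueness,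
but only for words on larger letters, so a downward induction closes the circle (`uniqueAbove`).

Since the leftmost letter of `w` acts last in `F_w`, the state of `i` is set by the first `i` in
`w`, and it is the vertex word of `i`. Reconstruction on the letters `> i` gives the inductive step
for this, and reconstruction on the letters `≤ k` gives (ii). -/

theorem IsCanonical.special {n : ℕ} {w : Word n} (hw : IsCanonical w) {x u y : Word n} {a : Fin n}
    (h : w = x ++ a :: (u ++ a :: y)) : (∃ j ∈ u, a < j) ∧ ∃ k ∈ u, k < a :=
  hw a u ⟨x, y, by simp [h]⟩

theorem isCanonical_of_special {n : ℕ} {w : Word n}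
    (h : ∀ (x u y : Word n) (a : Fin n), w = x ++ a :: (u ++ a :: y) →
      (∃ j ∈ u, a < j) ∧ ∃ k ∈ u, k < a) : IsCanonical w := by
  rintro a u ⟨x, y, rfl⟩
  exact h x u y a (by simp)

theorem IsCanonical.infix {n : ℕ} {v w : Word n} (hw : IsCanonical w) (h : v <:+: w) :
    IsCanonical v := fun a u hu => hw a u (hu.trans h)

theorem isCanonical_nil {n : ℕ} : IsCanonical ([] : Word n) := by
  intro a u h
  simp at h

theorem del_append {n : ℕ} (I : Finset (Fin n)) (u v : Word n) :
    del I (u ++ v) = del I u ++ del I v := List.filter_append ..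

theorem del_cons_of_mem {n : ℕ} {I : Finset (Fin n)} {a : Fin n} (h : a ∈ I) (v : Word n) :
    del I (a :: v) = del I v := by simp [del, h]

theorem del_cons_of_notMem {n : ℕ} {I : Finset (Fin n)} {a : Fin n} (h : a ∉ I) (v : Word n) :
    del I (a :: v) = a :: del I v := by simp [del, h]

theorem mem_del {n : ℕ} {I : Finset (Fin n)} {a : Fin n} {v : Word n} :
    a ∈ del I v ↔ a ∈ v ∧ a ∉ I := by simp [del]

theorem del_sublist {n : ℕ} (I : Finset (Fin n)) (v : Word n) : (del I v).Sublist v :=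
  List.filter_sublist

theorem del_eq_self {n : ℕ} {I : Finset (Fin n)} {v : Word n} (h : ∀ a ∈ v, a ∉ I) :
    del I v = v := by
  simpa [del] using h

theorem del_eq_nil {n : ℕ} {I : Finset (Fin n)} {v : Word n} (h : ∀ a ∈ v, a ∈ I) :
    del I v = [] := by
  simpa [del] using h

theorem del_del_of_subset {n : ℕ} {I J : Finset (Fin n)} (h : I ⊆ J) (v : Word n) :
    del J (del I v) = del J v := by
  simp only [del, List.filter_filter]
  refine List.filter_congr fun a _ => ?_
  have := @h a
  simp only [Bool.and_eq_left_iff_imp, decide_eq_true_eq]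
  tauto

theorem trunc_append {n : ℕ} {I : Finset (Fin n)} {x : Word n} (h : ∀ a ∈ x, a ∉ I) (y : Word n) :
    trunc I (x ++ y) = trunc I y := by
  simp only [trunc]
  rw [List.dropWhile_append_of_pos (by simpa using h)]

theorem trunc_cons_of_mem {n : ℕ} {I : Finset (Fin n)} {a : Fin n} (h : a ∈ I) (y : Word n) :
    trunc I (a :: y) = a :: y := by simp [trunc, h]

theorem trunc_eq_nil {n : ℕ} {I : Finset (Fin n)} {w : Word n} (h : ∀ a ∈ w, a ∉ I) :
    trunc I w = [] := by
  simpa [trunc] using trunc_append h []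

/-- Either no letter of `I` occurs in `w`, or `w` splits in front of the first such letter. -/
theorem notMem_or_exists_first {n : ℕ} (I : Finset (Fin n)) (w : Word n) :
    (∀ a ∈ w, a ∉ I) ∨
      ∃ (x : Word n) (a : Fin n) (y : Word n), w = x ++ a :: y ∧ (∀ b ∈ x, b ∉ I) ∧ a ∈ I := by
  induction w with
  | nil => simp
  | cons c w ih =>
    by_cases hc : c ∈ I
    · exact Or.inr ⟨[], c, w, rfl, by simp, hc⟩
    · rcases ih with ih | ⟨x, a, y, rfl, hx, ha⟩
      · exact Or.inl (by simpa [hc] using ih)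
      · exact Or.inr ⟨c :: x, a, y, rfl, by simpa [hc] using hx, ha⟩

theorem exists_first {n : ℕ} {a : Fin n} {w : Word n} (h : a ∈ w) :
    ∃ x y : Word n, w = x ++ a :: y ∧ a ∉ x := by
  rcases notMem_or_exists_first {a} w with h' | ⟨x, b, y, rfl, hx, hb⟩
  · exact absurd h (by simpa using fun h => h' a h)
  · obtain rfl : b = a := by simpa using hb
    exact ⟨x, y, rfl, fun h => hx _ h (by simp)⟩

/-! ### Invariants of the class of a word -/

/-- The class of the word obtained, by erasing the letters `≤ d`, from what follows the first
occurrence of `d`. -/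
def tailClass {n : ℕ} (d : Fin n) : Word n → Option (K n)
  | [] => none
  | a :: w => if a = d then some (proj (del (Finset.Iic d) w)) else tailClass d w

/-- The action of the letter `a` on the pairs formed by `proj (del (Iic d) w)` and
`tailClass d w`. -/
def tailAct {n : ℕ} (d a : Fin n) : Function.End (K n × Option (K n)) := fun s =>
  (if a ≤ d then s.1 else proj [a] * s.1, if a = d then some s.1 else s.2)

theorem end_mul_apply {α : Type*} (f g : Function.End α) (x : α) : (f * g) x = f (g x) := rfl

/-- Erasing the letters `≤ d` respects the relations. The second component is overwritten by each
further `d` on the left, so only the leftmost `d` counts. -/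
theorem tailAct_rel {n : ℕ} (d : Fin n) (u v : FreeMonoid (Fin n)) (h : Rel n u v) :
    FreeMonoid.lift (tailAct d) u = FreeMonoid.lift (tailAct d) v := by
  cases h with
  | idem i =>
    simp only [map_mul, FreeMonoid.lift_eval_of]
    funext s
    simp only [end_mul_apply, tailAct]
    by_cases h1 : i ≤ d <;> by_cases h2 : i = d <;> simp_all [← mul_assoc, proj_idem]
  | left i j h =>
    simp only [map_mul, FreeMonoid.lift_eval_of]
    funext s
    simp only [end_mul_apply, tailAct]
    rcases lt_trichotomy i d with h1 | rfl | h1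
    · by_cases h3 : j ≤ d <;> by_cases h2 : j = d <;> simp_all [h1.le, h1.ne]
    · simp_all [h.not_ge]
    · have h2 := h1.trans h
      simp [h1.not_ge, h1.ne', h2.not_ge, h2.ne', ← mul_assoc, proj_left h]
  | right i j h =>
    simp only [map_mul, FreeMonoid.lift_eval_of]
    funext s
    simp only [end_mul_apply, tailAct]
    rcases lt_trichotomy i d with h1 | rfl | h1
    · by_cases h3 : j ≤ d <;> by_cases h2 : j = d <;>
        simp_all [h1.le, h1.ne, ← mul_assoc, proj_idem]
    · simp_all [h.not_ge, h.ne', ← mul_assoc, proj_idem]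
    · have h2 := h1.trans h
      simp [h1.not_ge, h1.ne', h2.not_ge, h2.ne', ← mul_assoc, proj_right h]

theorem lift_tailAct {n : ℕ} (d : Fin n) (w : Word n) :
    FreeMonoid.lift (tailAct d) (FreeMonoid.ofList w) (1, none) =
      (proj (del (Finset.Iic d) w), tailClass d w) := by
  induction w with
  | nil => rfl
  | cons a w ih =>
    rw [FreeMonoid.ofList_cons, map_mul, FreeMonoid.lift_eval_of, end_mul_apply, ih]
    by_cases h : a ≤ d
    · simp [tailAct, tailClass, h, del_cons_of_mem]
    · rw [del_cons_of_notMem (by simpa using h), proj_cons]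
      simp [tailAct, tailClass, h]

theorem tail_invariants {n : ℕ} {u v : Word n} (h : proj u = proj v) (d : Fin n) :
    proj (del (Finset.Iic d) u) = proj (del (Finset.Iic d) v) ∧
      tailClass d u = tailClass d v := by
  have key : ∀ w : Word n, PresentedMonoid.lift (tailAct d) (tailAct_rel d) (proj w) (1, none) =
      (proj (del (Finset.Iic d) w), tailClass d w) := fun w => lift_tailAct d w
  have := (key u).symm.trans ((congrArg (fun x =>
    PresentedMonoid.lift (tailAct d) (tailAct_rel d) x (1, none)) h).trans (key v))
  simpa using this

theorem tailClass_eq_none_iff {n : ℕ} {d : Fin n} {w : Word n} : tailClass d w = none ↔ d ∉ w := by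
  induction w with
  | nil => simp [tailClass]
  | cons a w ih =>
    by_cases h : a = d
    · simp [tailClass, h]
    · simp [tailClass, h, ih, Ne.symm h]

theorem tailClass_append_cons {n : ℕ} {d : Fin n} {x : Word n} (hx : d ∉ x) (y : Word n) :
    tailClass d (x ++ d :: y) = some (proj (del (Finset.Iic d) y)) := by
  induction x with
  | nil => simp [tailClass]
  | cons a x ih =>
    simp only [List.mem_cons, not_or] at hx
    simp [tailClass, Ne.symm hx.1, ih hx.2]

theorem mem_iff_of_proj_eq {n : ℕ} {u v : Word n} (h : proj u = proj v) (d : Fin n) :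
    d ∈ u ↔ d ∈ v := by
  rw [← not_iff_not, ← tailClass_eq_none_iff, ← tailClass_eq_none_iff, (tail_invariants h d).2]

theorem tailClass_del {n : ℕ} {b d : Fin n} (h : b < d) (w : Word n) :
    tailClass d (del (Finset.Iic b) w) = tailClass d w := by
  induction w with
  | nil => rfl
  | cons a w ih =>
    by_cases hab : a ≤ b
    · rw [del_cons_of_mem (by simpa using hab), ih]
      simp [tailClass, (hab.trans_lt h).ne]
    · rw [del_cons_of_notMem (by simpa using hab)]
      simp only [tailClass, ih]
      rw [del_del_of_subset (Finset.Iic_subset_Iic.2 h.le)]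

/-! ### Canonical representatives and vertex words. -/

theorem can_spec {n : ℕ} (w : Word n) : proj (can w) = proj w ∧ IsCanonical (can w) :=
  (exists_canonical w).choose_spec

/-- No uniqueness is needed here: the choice is made from a predicate that depends only on the
class. -/
theorem can_congr {n : ℕ} {u v : Word n} (h : proj u = proj v) : can u = can v := by
  unfold can
  congr! 2
  simp [h]

/-- The word `a_d Can u`, where `u` is obtained, by erasing the letters `≤ d`, from what follows
the first occurrence of `d` in `w`; the empty word if `d` does not occur in `w`. -/
noncomputable def vertexWord {n : ℕ} (d : Fin n) : Word n → Word n
  | [] => []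
  | a :: w => if a = d then d :: can (del (Finset.Iic d) w) else vertexWord d w

theorem vertexWord_of_notMem {n : ℕ} {d : Fin n} {w : Word n} (h : d ∉ w) :
    vertexWord d w = [] := by
  induction w with
  | nil => rfl
  | cons a w ih =>
    simp only [List.mem_cons, not_or] at h
    simp [vertexWord, Ne.symm h.1, ih h.2]

theorem vertexWord_append_cons {n : ℕ} {d : Fin n} {x : Word n} (hx : d ∉ x) (y : Word n) :
    vertexWord d (x ++ d :: y) = d :: can (del (Finset.Iic d) y) := by
  induction x with
  | nil => simp [vertexWord]
  | cons a x ih =>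
    simp only [List.mem_cons, not_or] at hx
    simp [vertexWord, Ne.symm hx.1, ih hx.2]

theorem vertexWord_congr {n : ℕ} {d : Fin n} {u v : Word n} (h : tailClass d u = tailClass d v) :
    vertexWord d u = vertexWord d v := by
  by_cases hu : d ∈ u
  · have hv : d ∈ v := by
      by_contra hv
      exact tailClass_eq_none_iff.1 (h.trans (tailClass_eq_none_iff.2 hv)) hu
    obtain ⟨x, y, rfl, hx⟩ := exists_first hu
    obtain ⟨x', y', rfl, hx'⟩ := exists_first hv
    rw [tailClass_append_cons hx, tailClass_append_cons hx', Option.some_inj] at h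
    rw [vertexWord_append_cons hx, vertexWord_append_cons hx', can_congr h]
  · rw [vertexWord_of_notMem hu,
      vertexWord_of_notMem (tailClass_eq_none_iff.1 (h ▸ tailClass_eq_none_iff.2 hu))]

/-! ### Deletion of the second letter of a factor `a u a` -/

/-- Each factor `a u a` of the word contains a letter larger than `a`. -/
def UpperSpecial {n : ℕ} (w : Word n) : Prop :=
  ∀ (x u y : Word n) (a : Fin n), w = x ++ a :: (u ++ a :: y) → ∃ j ∈ u, a < j

theorem UpperSpecial.delete {n : ℕ} {x v t : Word n} {c : Fin n}
    (h : UpperSpecial (x ++ c :: v ++ c :: t)) (hv : ∀ j ∈ v, c ≤ j) :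
    UpperSpecial (x ++ c :: v ++ t) := by
  -- Only a factor `e … e` running across the deleted `c` can lose its larger letter. If that letter
  -- is `c > e`, the left `e` cannot lie in `c v`, so the factor also contains the first `c`.
  have straddle : ∀ (p r q s : Word n) (e : Fin n), x ++ c :: v = p ++ e :: r → t = q ++ e :: s →
      ∃ j ∈ r ++ q, e < j := by
    intro p r q s e hX ht
    obtain ⟨j, hj, hej⟩ := h p (r ++ c :: q) s e (by rw [hX, ht]; simp)
    by_cases hjc : j = c
    · subst hjc
      rcases List.append_eq_append_iff.1 hX with ⟨o, rfl, ho⟩ | ⟨o, rfl, ho⟩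
      · rcases o with _ | ⟨o', o⟩ <;> simp only [List.nil_append, List.cons_append,
          List.cons.injEq] at ho
        · exact absurd hej (by simp [ho.1])
        · exact absurd (hv e (by simp [ho.2])) hej.not_ge
      · rcases o with _ | ⟨o', o⟩ <;> simp only [List.nil_append, List.cons_append,
          List.cons.injEq] at ho
        · exact absurd hej (by simp [ho.1])
        · exact ⟨j, by simp [ho.2], hej⟩
    · exact ⟨j, by simpa [hjc] using hj, hej⟩
  intro p u s e heq
  rcases List.append_eq_append_iff.1 heq with ⟨r, rfl, ht⟩ | ⟨r, hX, hr⟩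
  · exact h (x ++ c :: v ++ c :: r) u s e (by simp [ht])
  rcases r with _ | ⟨e', r⟩
  · exact h (x ++ c :: v ++ [c]) u s e (by simp at hr; simp [← hr])
  simp only [List.cons_append, List.cons.injEq] at hr
  obtain ⟨rfl, hr⟩ := hr
  rcases List.append_eq_append_iff.1 hr with ⟨q, rfl, ht⟩ | ⟨q, rfl, ht⟩
  · rcases q with _ | ⟨e', q⟩
    · simpa using straddle p u [] s e (by simpa using hX) (by simpa using ht.symm)
    · simp only [List.cons_append, List.cons.injEq] at ht
      obtain ⟨rfl, rfl⟩ := ht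
      exact h p u (q ++ c :: t) e (by rw [hX]; simp)
  · exact straddle p r q s e hX ht

/-- A letter larger than some `a ≥ k` survives the erasure; only the smaller letters of a factor may
be lost. -/
theorem IsCanonical.upperSpecial_del {n : ℕ} {w : Word n} (hw : IsCanonical w) (k : Fin n) :
    UpperSpecial (del (Finset.Iio k) w) := by
  intro x u y a h
  obtain ⟨l₁, l₂, rfl, -, h₂⟩ := List.filter_eq_append_iff.1 h
  obtain ⟨m₁, m₂, rfl, -, hak, h₃⟩ := List.filter_eq_cons_iff.1 h₂
  obtain ⟨q₁, q₂, rfl, rfl, h₄⟩ := List.filter_eq_append_iff.1 h₃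
  obtain ⟨o₁, o₂, rfl, ho, -, -⟩ := List.filter_eq_cons_iff.1 h₄
  obtain ⟨⟨j, hj, haj⟩, -⟩ := hw.special (x := l₁ ++ m₁) (u := q₁ ++ o₁) (y := o₂) (a := a)
    (by simp)
  have hk : k ≤ j := le_trans (by simpa using hak) haj.le
  rcases List.mem_append.1 hj with hj | hj
  · exact ⟨j, List.mem_filter.2 ⟨hj, by simpa using hk⟩, haj⟩
  · exact absurd hk (by simpa using ho j hj)

/-- The canonical form of `u v`, for a canonical word `u` and an `UpperSpecial` product `u v`, is
obtained by deleting letters of `v` only. -/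
theorem exists_canonical_append {n : ℕ} {u : Word n} (hu : IsCanonical u) (v : Word n)
    (h : UpperSpecial (u ++ v)) :
    ∃ z : Word n, z.Sublist v ∧ IsCanonical (u ++ z) ∧
      ∀ (x y : Word n) (b : Fin n), u = x ++ b :: y →
        proj (del (Finset.Iic b) (y ++ z)) = proj (del (Finset.Iic b) (y ++ v)) := by
  induction hl : v.length using Nat.strong_induction_on generalizing v with
  | _ l ih =>
    subst hl
    by_cases hcan : IsCanonical (u ++ v)
    · exact ⟨v, List.Sublist.refl v, hcan, fun _ _ _ _ => rfl⟩
    -- By `UpperSpecial`, canonicity fails only at a factor `c t c` without letters smaller than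
    -- `c`; its second `c` is redundant.
    obtain ⟨p, t, s, c, huv, hc⟩ : ∃ (p t s : Word n) (c : Fin n),
        u ++ v = p ++ c :: (t ++ c :: s) ∧ ∀ j ∈ t, c ≤ j := by
      by_contra hcon
      push Not at hcon
      exact hcan (isCanonical_of_special fun x t y a hx => ⟨h x t y a hx, hcon x t y a hx⟩)
    obtain ⟨r, rfl, hr⟩ : ∃ r, v = r ++ c :: s ∧ u ++ r = p ++ c :: t := by
      have huv' : u ++ v = (p ++ c :: t) ++ c :: s := by simp [huv]
      rcases List.append_eq_append_iff.1 huv' with ⟨r, hr, hv⟩ | ⟨r, hr, hv⟩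
      · exact ⟨r, hv, hr.symm⟩
      · rcases r with _ | ⟨c', r⟩
        · exact ⟨[], hv.symm, by simpa using hr⟩
        · simp only [List.cons_append, List.cons.injEq] at hv
          obtain ⟨rfl, -⟩ := hv
          -- The second `c` cannot lie in `u`, which is canonical.
          obtain ⟨-, j, hj, hjc⟩ := hu.special (x := p) (u := t) (y := r) (a := c) (by simp [hr])
          exact absurd (hc j hj) hjc.not_ge
    obtain ⟨z, hz, hcz, hinv⟩ := ih (r ++ s).length (by simp) (r ++ s) (by
      rw [← List.append_assoc, hr]
      refine UpperSpecial.delete ?_ hc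
      rwa [← hr, List.append_assoc]) rfl
    refine ⟨z, hz.trans (by simp), hcz, fun x y b hx => (hinv x y b hx).trans ?_⟩
    -- If `c ≤ b`, the deleted letter is erased anyway. Otherwise `b` does not occur in `c t`, so `c
    -- t` lies after `b` and the cancellation `c t c = c t` takes place there.
    by_cases hcb : c ≤ b
    · simp only [del_append, del_cons_of_mem (Finset.mem_Iic.2 hcb)]
    have hsplit : ∃ q, y ++ r = q ++ c :: t := by
      have hr' : x ++ b :: (y ++ r) = p ++ c :: t := by rw [← hr, hx]; simp
      rcases List.append_eq_append_iff.1 hr' with ⟨q, rfl, hq⟩ | ⟨q, rfl, hq⟩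
      · rcases q with _ | ⟨q', q⟩ <;> simp only [List.nil_append, List.cons_append,
          List.cons.injEq] at hq
        · exact absurd hq.1.ge hcb
        · exact ⟨q, hq.2⟩
      · rcases q with _ | ⟨q', q⟩ <;> simp only [List.nil_append, List.cons_append,
          List.cons.injEq] at hq
        · exact absurd hq.1.le hcb
        · exact absurd (hc b (by simp [hq.2])) hcb
    obtain ⟨q, hq⟩ := hsplit
    rw [← List.append_assoc, ← List.append_assoc, hq]
    have hcd (m : K n) : proj [c] * (proj (del (Finset.Iic b) t) * (proj [c] * m)) =
        proj [c] * (proj (del (Finset.Iic b) t) * m) := by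
      simp only [← mul_assoc, proj_cancel_right c (del (Finset.Iic b) t) fun j hj =>
        hc j (mem_del.1 hj).1]
    simp only [del_append, del_cons_of_notMem (mt Finset.mem_Iic.1 hcb), proj_append,
      proj_cons c (del _ _), mul_assoc, hcd]

/-- If what follows `g` in a canonical word represents, up to letters `≤ b`, the whole word, then
all letters of `g` are `≤ b`. -/
theorem le_of_proj_del_eq {n : ℕ} (b : Fin n) (g h z : Word n) (hgh : IsCanonical (g ++ h))
    (hz : z.Sublist h)
    (hp : proj (del (Finset.Iic b) z) = proj (del (Finset.Iic b) (g ++ h))) : ∀ d ∈ g, d ≤ b := by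
  induction b using WellFoundedGT.induction generalizing g h z with
  | ind b ih =>
    by_contra! hcon
    obtain ⟨d, hd, hbd, hmax⟩ : ∃ d ∈ g, b < d ∧ ∀ e ∈ g, e ≤ d := by
      obtain ⟨d₀, hd₀, hbd₀⟩ := hcon
      obtain ⟨d, hd, hmax⟩ := g.toFinset.exists_max_image id ⟨d₀, by simpa using hd₀⟩
      simp only [List.mem_toFinset, id] at hd hmax
      exact ⟨d, hd, hbd₀.trans_le (hmax d₀ hd₀), hmax⟩
    have hdz : d ∈ z := by
      have := (mem_iff_of_proj_eq hp d).2 (mem_del.2 ⟨by simp [hd], by simpa using hbd⟩)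
      exact (mem_del.1 this).1
    have htail := (tail_invariants hp d).2
    rw [tailClass_del hbd, tailClass_del hbd] at htail
    obtain ⟨g₁, g₂, rfl, hg₁⟩ := exists_first hd
    obtain ⟨z₁, z₂, rfl, hz₁⟩ := exists_first hdz
    obtain ⟨h₁, h₂, rfl, hh₁⟩ := exists_first (hz.subset hdz)
    rw [tailClass_append_cons hz₁, List.append_assoc, List.cons_append,
      tailClass_append_cons hg₁, Option.some_inj, del_append,
      del_eq_nil (v := g₂) fun a ha => by simpa using hmax a (by simp [ha]), List.nil_append]
      at htail
    have hz₂ : z₂.Sublist h₂ := by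
      have hs : (d :: z₂).Sublist (h₁ ++ d :: h₂) := (List.sublist_append_right z₁ _).trans hz
      obtain ⟨s₁, s₂, hs, hs₁, hs₂⟩ := List.sublist_append_iff.1 hs
      rcases s₁ with _ | ⟨d', s₁⟩
      · simp only [List.nil_append] at hs
        subst hs
        exact List.cons_sublist_cons.1 hs₂
      · simp only [List.cons_append, List.cons.injEq] at hs
        exact absurd (hs₁.subset (by simp [hs.1])) hh₁
    -- As `d` is the largest letter of `g`, erasing the letters `≤ d` removes `g₂`, and the tails
    -- after the first `d` satisfy the hypothesis again, now for `d`. So the factor `d g₂ h₁ d` has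
    -- no letter larger than `d`, which canonicity forbids.
    have hle := ih d hbd (h₁ ++ [d]) h₂ z₂
      (hgh.infix ⟨g₁ ++ d :: g₂, [], by simp⟩) hz₂ (by simpa using htail)
    obtain ⟨⟨j, hj, hdj⟩, -⟩ := hgh.special (x := g₁) (u := g₂ ++ h₁) (y := h₂) (a := d) (by simp)
    rcases List.mem_append.1 hj with hj | hj
    · exact absurd (hmax j (by simp [hj])) hdj.not_ge
    · exact absurd (hle j (by simp [hj])) hdj.not_ge

/-! ### Joins -/

theorem join_of_sublist {n : ℕ} {u v : Word n} (h : u.Sublist v) : join u v = v := by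
  cases u with
  | nil => rfl
  | cons a u => simp [join, h]

theorem join_append_cons {n : ℕ} {x z v : Word n} {b : Fin n} (hz : z.Sublist v)
    (hb : ¬ (b :: z).Sublist v) : join (x ++ b :: z) v = x ++ b :: v := by
  induction x with
  | nil => simp [join, hb, join_of_sublist hz]
  | cons a x ih =>
    have : ¬ (a :: (x ++ b :: z)).Sublist v := fun h =>
      hb (((List.sublist_append_right x _).trans (List.sublist_cons_self a _)).trans h)
    simp [join, this, ih]

/-- Canonical words on the letters `> k` are determined by their classes. -/
def UniqueAbove {n : ℕ} (k : Fin n) : Prop :=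
  ∀ u v : Word n, IsCanonical u → IsCanonical v → (∀ a ∈ u, k < a) → (∀ a ∈ v, k < a) →
    proj u = proj v → u = v

theorem UniqueAbove.can_eq {n : ℕ} {k : Fin n} (hk : UniqueAbove k) {u v : Word n}
    (hu : IsCanonical u) (hv : ∀ a ∈ v, k < a) (h : proj u = proj v) : can v = u :=
  hk _ _ (can_spec v).2 hu
    (fun a ha => hv a ((mem_iff_of_proj_eq (can_spec v).1 a).1 ha))
    (fun a ha => hv a ((mem_iff_of_proj_eq h a).1 ha)) ((can_spec v).1.trans h.symm)

/-- Each class contains a canonical quasi-subword of any of its words. -/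
theorem exists_canonical_sublist {n : ℕ} (w : Word n) :
    ∃ v : Word n, v.Sublist w ∧ proj v = proj w ∧ IsCanonical v := by
  induction hl : w.length using Nat.strong_induction_on generalizing w with
  | _ l ih =>
    subst hl
    by_cases hw : IsCanonical w
    · exact ⟨w, List.Sublist.refl w, rfl, hw⟩
    obtain ⟨w', hs, hlt, hp⟩ : ∃ w' : Word n, w'.Sublist w ∧ w'.length < w.length ∧
        proj w' = proj w := by
      by_contra! hcon
      refine hw (isCanonical_of_special fun x u y a hx => ⟨?_, ?_⟩)
      · by_contra! hle
        refine hcon (x ++ (u ++ a :: y)) (by simp [hx]) (by simp [hx]) ?_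
        simp only [hx, proj_append, proj_cons a (u ++ _), proj_cons a y]
        rw [← mul_assoc (proj u), ← mul_assoc (proj [a]), ← mul_assoc (proj [a]) (proj u),
          proj_cancel_left a u hle]
      · by_contra! hle
        refine hcon (x ++ a :: (u ++ y)) (by simp [hx]) (by simp [hx]) ?_
        rw [hx, proj_append, proj_append, proj_cons a (u ++ _), proj_cons a (u ++ _), proj_append,
          proj_append, proj_cons a y, ← mul_assoc (proj [a]), ← proj_cancel_right a u hle]
        simp only [mul_assoc]
    obtain ⟨v, hv, hpv, hcv⟩ := ih _ hlt w' rfl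
    exact ⟨v, hv.trans hs, hpv.trans hp, hcv⟩

/-- A canonical form can be reached by deletions alone, and by uniqueness it is the chosen one. -/
theorem UniqueAbove.vertexWord_sublist {n : ℕ} {k : Fin n} (hk : UniqueAbove k) (w : Word n) :
    (vertexWord k w).Sublist w := by
  by_cases hw : k ∈ w
  · obtain ⟨x, y, rfl, hx⟩ := exists_first hw
    obtain ⟨v, hv, hpv, hcv⟩ := exists_canonical_sublist (del (Finset.Iic k) y)
    rw [vertexWord_append_cons hx, hk.can_eq hcv (fun a ha => by simpa using (mem_del.1 ha).2) hpv]
    exact ((hv.trans (del_sublist _ _)).cons_cons k).trans (List.sublist_append_right _ _)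
  · simp [vertexWord_of_notMem hw]

theorem vertexWord_append {n : ℕ} {d : Fin n} {x : Word n} (hx : d ∉ x) (y : Word n) :
    vertexWord d (x ++ y) = vertexWord d y := by
  induction x with
  | nil => rfl
  | cons a x ih =>
    simp only [List.mem_cons, not_or] at hx
    simp [vertexWord, Ne.symm hx.1, ih hx.2]

theorem trunc_Iio_spec {n : ℕ} (k : Fin n) (w : Word n) :
    ∃ x : Word n, w = x ++ trunc (Finset.Iio k) w ∧ (∀ a ∈ x, k ≤ a) ∧
      ∀ I, Finset.Iio k ⊆ I → trunc I (trunc (Finset.Iio k) w) = trunc (Finset.Iio k) w := by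
  rcases notMem_or_exists_first (Finset.Iio k) w with h | ⟨x, a, y, rfl, hx, ha⟩
  · rw [trunc_eq_nil h]
    exact ⟨w, by simp, fun a ha => by simpa using h a ha, fun _ _ => rfl⟩
  · rw [trunc_append hx, trunc_cons_of_mem ha]
    exact ⟨x, rfl, fun a ha => by simpa using hx a ha, fun I hI => trunc_cons_of_mem (hI ha) y⟩

/-! ### Rebuilding a canonical word from its vertex words. -/

theorem IsCanonical.trunc_Iic {n : ℕ} {w : Word n} (hw : IsCanonical w) {k : Fin n}
    (hk : k ∈ w → UniqueAbove k) :
    trunc (Finset.Iic k) w = join (vertexWord k w) (trunc (Finset.Iio k) w) := by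
  obtain ⟨x, hx, hxk, hA⟩ := trunc_Iio_spec k w
  set A := trunc (Finset.Iio k) w with hAdef
  have hA := hA (Finset.Iic k) Finset.Iio_subset_Iic_self
  clear_value A
  subst hx
  by_cases hkx : k ∈ x
  · obtain ⟨x, y, rfl, hkx'⟩ := exists_first hkx
    have hky : k ∉ y := by
      intro hky
      obtain ⟨y₁, y₂, rfl⟩ := List.append_of_mem hky
      obtain ⟨-, j, hj, hjk⟩ := hw.special (x := x) (u := y₁) (y := y₂ ++ A) (a := k) (by simp)
      exact absurd (hxk j (by simp [hj])) hjk.not_ge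
    have hy : ∀ a ∈ y, k < a := fun a ha =>
      lt_of_le_of_ne (hxk a (by simp [ha])) fun h => hky (h ▸ ha)
    have hkyA : IsCanonical (k :: y ++ A) := hw.infix
      (by simpa using (List.suffix_append x (k :: (y ++ A))).isInfix)
    have hdel : del (Finset.Iio k) (k :: y ++ A) = k :: y ++ del (Finset.Iio k) A := by
      rw [del_append, del_eq_self]
      intro a ha
      rcases List.mem_cons.1 ha with rfl | ha
      · simp
      · simpa using (hy a ha).le
    obtain ⟨z, hz, hcz, hinv⟩ := exists_canonical_append
      (hkyA.infix (List.prefix_append _ _).isInfix) (del (Finset.Iio k) A)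
      (hdel ▸ hkyA.upperSpecial_del k)
    have hzA := hz.trans (del_sublist _ _)
    have hkz : ∀ a ∈ z, k < a := by
      refine fun a ha => lt_of_le_of_ne (by simpa using (mem_del.1 (hz.subset ha)).2) ?_
      rintro rfl
      obtain ⟨z₁, z₂, rfl⟩ := List.append_of_mem ha
      obtain ⟨-, j, hj, hjk⟩ := hcz.special (x := []) (u := y ++ z₁) (y := z₂) (a := k) (by simp)
      rcases List.mem_append.1 hj with hj | hj
      · exact hjk.not_gt (hy j hj)
      · exact absurd hjk (by simpa using (mem_del.1 (hz.subset (by simp [hj] : j ∈ _))).2)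
    have hvertex : vertexWord k (x ++ k :: y ++ A) = k :: y ++ z := by
      have h := hinv [] y k rfl
      rw [del_eq_self (v := y ++ z) fun a ha => by
          simpa using (List.mem_append.1 ha).elim (hy a) (hkz a), del_append,
        del_del_of_subset Finset.Iio_subset_Iic_self, ← del_append] at h
      rw [List.append_assoc, List.cons_append, vertexWord_append_cons hkx',
        (hk (by simp)).can_eq (u := y ++ z) (hcz.infix (List.suffix_cons _ _).isInfix)
          (fun a ha => by simpa using (mem_del.1 ha).2) h]
      rfl
    -- The join keeps `k y` in full as soon as its last letter `b` cannot be matched together with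
    -- `z` inside `A`.
    obtain ⟨y', b, hyb⟩ : ∃ (y' : Word n) (b : Fin n), k :: y = y' ++ [b] :=
      ⟨_, _, (List.dropLast_append_getLast (List.cons_ne_nil k y)).symm⟩
    have hkb : k ≤ b := by
      have : b ∈ k :: y := by simp [hyb]
      rcases List.mem_cons.1 this with rfl | h
      · exact le_rfl
      · exact (hy b h).le
    have hbz : ¬ (b :: z).Sublist A := by
      intro hs
      obtain ⟨g, h, rfl, hg⟩ := exists_first (hs.subset (by simp : b ∈ b :: z))
      have hzh : z.Sublist h := by
        obtain ⟨s₁, s₂, hs, hs₁, hs₂⟩ := List.sublist_append_iff.1 hs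
        rcases s₁ with _ | ⟨d', s₁⟩
        · simp only [List.nil_append] at hs
          subst hs
          exact List.cons_sublist_cons.1 hs₂
        · simp only [List.cons_append, List.cons.injEq] at hs
          exact absurd (hs₁.subset (by simp [hs.1])) hg
      have hp := hinv y' [] b hyb
      rw [List.nil_append, List.nil_append, del_del_of_subset
        (Finset.Iio_subset_Iic_self.trans (Finset.Iic_subset_Iic.2 hkb))] at hp
      -- If `b z` were a quasi-subword of `A = g b h`, with `b` not in `g`, all letters of `g` would
      -- be `≤ b`. But `b g b` is a factor of a canonical word.
      have hle := le_of_proj_del_eq b (g ++ [b]) h z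
        (hkyA.infix (by simpa using (List.suffix_append (k :: y) (g ++ b :: h)).isInfix)) hzh
        (by simpa using hp)
      obtain ⟨⟨j, hj, hbj⟩, -⟩ := hkyA.special (x := y') (u := g) (y := h) (a := b)
        (by rw [hyb]; simp)
      exact absurd (hle j (by simp [hj])) hbj.not_ge
    rw [hvertex, List.append_assoc, trunc_append, List.cons_append,
      trunc_cons_of_mem (by simp), ← List.cons_append, hyb]
    · simpa using (join_append_cons (x := y') hzA hbz).symm
    · intro a ha
      simpa using lt_of_le_of_ne (hxk a (by simp [ha])) fun h => hkx' (h ▸ ha)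
  -- Any `k` now lies inside `A`, so its vertex word is a quasi-subword of `A` and the join absorbs
  -- it.
  · rw [trunc_append, hA, vertexWord_append hkx, join_of_sublist]
    · by_cases hkA : k ∈ A
      · exact (hk (by simp [hkA])).vertexWord_sublist A
      · simp [vertexWord_of_notMem hkA]
    · intro a ha
      simpa using lt_of_le_of_ne (hxk a ha) fun h => hkx (h ▸ ha)

/-- The list is an initial segment of the alphabet in increasing order, so each new letter `k` meets
the truncation at exactly the letters `< k`. -/
theorem IsCanonical.iterJoin_vertexWord {n : ℕ} {w : Word n} (hw : IsCanonical w)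
    (hu : ∀ k ∈ w, UniqueAbove k) (l : List (Fin n)) (hl : l.Pairwise (· < ·))
    (hdown : ∀ i ∈ l, ∀ j < i, j ∈ l) :
    iterJoin (l.map fun i => vertexWord i w) = trunc l.toFinset w := by
  induction l using List.reverseRecOn with
  | nil => simp [iterJoin_nil, trunc_eq_nil]
  | append_singleton l k ih =>
    obtain ⟨hl', -, hlk⟩ := List.pairwise_append.1 hl
    have hlk : ∀ j ∈ l, j < k := fun j hj => hlk j hj k (by simp)
    have hkl : ∀ j < k, j ∈ l := fun j hj => by
      simpa [hj.ne] using hdown k (by simp) j hj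
    have hset : l.toFinset = Finset.Iio k := by
      ext j
      simpa using ⟨hlk j, hkl j⟩
    have hset' : (l ++ [k]).toFinset = Finset.Iic k := by
      rw [List.toFinset_append, hset]
      ext j
      simp [le_iff_lt_or_eq]
    rw [List.map_append, List.map_singleton, iterJoin_concat,
      ih hl' (fun i hi j hj => hkl j (hj.trans (hlk i hi))), hset, hset', hw.trunc_Iic (hu k)]

theorem IsCanonical.iterJoin_finRange {n : ℕ} {w : Word n} (hw : IsCanonical w)
    (hu : ∀ k ∈ w, UniqueAbove k) :
    iterJoin ((List.finRange n).map fun i => vertexWord i w) = w := by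
  rw [hw.iterJoin_vertexWord hu _ (List.pairwise_lt_finRange n) (by simp)]
  cases w with
  | nil => rfl
  | cons a w => exact trunc_cons_of_mem (by simp) w

/-! ### Uniqueness of canonical words. -/

/-- Rebuilding a word on letters `> k` uses uniqueness above those letters only, whence the downward
induction. -/
theorem uniqueAbove {n : ℕ} (k : Fin n) : UniqueAbove k := by
  induction k using WellFoundedGT.induction with
  | ind k ih =>
    intro u v hu hv hku hkv h
    rw [← hu.iterJoin_finRange fun a ha => ih a (hku a ha),
      ← hv.iterJoin_finRange fun a ha => ih a (hkv a ha)]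
    simp only [vertexWord_congr (tail_invariants h _).2]

theorem IsCanonical.eq_of_proj_eq {n : ℕ} {u v : Word n} (hu : IsCanonical u) (hv : IsCanonical v)
    (h : proj u = proj v) : u = v := by
  rw [← hu.iterJoin_finRange fun a _ => uniqueAbove a,
    ← hv.iterJoin_finRange fun a _ => uniqueAbove a]
  simp only [vertexWord_congr (tail_invariants h _).2]

theorem IsCanonical.can_eq {n : ℕ} {u v : Word n} (hu : IsCanonical u) (h : proj v = proj u) :
    can v = u :=
  (can_spec v).2.eq_of_proj_eq hu ((can_spec v).1.trans h)

/-! ### The system state -/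

theorem iterJoin_filter {n : ℕ} {ι : Type*} (l : List ι) (p : ι → Bool) (f : ι → Word n)
    (h : ∀ i ∈ l, p i = false → f i = []) :
    iterJoin ((l.filter p).map f) = iterJoin (l.map f) := by
  induction l using List.reverseRecOn with
  | nil => rfl
  | append_singleton l k ih =>
    have ih := ih fun i hi => h i (by simp [hi])
    rw [List.filter_append, List.map_append, List.map_append, List.map_singleton, iterJoin_concat,
      ← ih]
    cases hp : p k
    · rw [h k (by simp) hp]
      simp [hp, join]
    · rw [List.filter_singleton, hp]
      exact iterJoin_concat _ _

theorem vertexWord_del {n : ℕ} {i j : Fin n} (h : i < j) (w : Word n) :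
    vertexWord j (del (Finset.Iic i) w) = vertexWord j w :=
  vertexWord_congr (tailClass_del h w)

/-- This rebuilds the right-hand side: erasing letters `≤ i` does not affect the vertex words of
larger letters, and empties the others, which are neutral for the join. -/
theorem iterJoin_vertexWord_Ioi {n : ℕ} (i : Fin n) (w : Word n) :
    iterJoin (((List.finRange n).filter fun j => i < j).map fun j => vertexWord j w) =
      can (del (Finset.Iic i) w) := by
  obtain ⟨hp, hc⟩ := can_spec (del (Finset.Iic i) w)
  rw [← hc.iterJoin_finRange fun a _ => uniqueAbove a,
    ← iterJoin_filter (List.finRange n) (fun j => decide (i < j))]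
  · congr 1
    refine List.map_congr_left fun j hj => ?_
    rw [vertexWord_congr (tail_invariants hp j).2, vertexWord_del]
    simpa using (List.mem_filter.1 hj).2
  · intro j _ hj
    refine vertexWord_of_notMem fun hmem => ?_
    have := (mem_del.1 ((mem_iff_of_proj_eq hp j).1 hmem)).2
    simp at this hj
    exact this.not_ge hj

theorem updateWord_eq {n : ℕ} (i : Fin n) (s : Fin n → Word n) :
    updateWord i (fun j => s j) =
      i :: iterJoin (((List.finRange n).filter fun j => i < j).map s) := by
  unfold updateWord
  congr 2
  induction List.finRange n with
  | nil => rfl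
  | cons a l ih =>
    by_cases h : i < a <;> simpa [h] using ih

theorem stateAt_cons {n : ℕ} (a : Fin n) (w : Word n) (i : Fin n) :
    stateAt (a :: w) i =
      if a = i then updateWord i (fun j => stateAt w j) else stateAt w i := by
  have : (starSystem n).eval (FreeMonoid.ofList (a :: w)) (starState n) =
      (starSystem n).localMap a
        ((starSystem n).eval (FreeMonoid.ofList w) (starState n)) := by
    rw [FreeMonoid.ofList_cons, map_mul, end_mul_apply]
    rfl
  unfold stateAt
  rw [this]
  by_cases h : a = i
  · subst h
    simp [UpdateSystem.localMap, starSystem]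
  · simp [UpdateSystem.localMap, h, Ne.symm h]

theorem stateAt_eq_vertexWord {n : ℕ} (w : Word n) (i : Fin n) :
    stateAt w i = vertexWord i w := by
  induction w generalizing i with
  | nil => rfl
  | cons a w ih =>
    rw [stateAt_cons, updateWord_eq i (stateAt w), vertexWord, ← iterJoin_vertexWord_Ioi,
      funext ih]

/-- After a leading `i`, any later `i` preceded only by letters `≥ i` is absorbed. -/
theorem proj_cons_del {n : ℕ} (i : Fin n) (w : Word n) (h : ∀ a ∈ w, i ≤ a) :
    proj (i :: del (Finset.Iic i) w) = proj (i :: w) := by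
  induction w using List.reverseRecOn with
  | nil => rfl
  | append_singleton w c ih =>
    have ih := ih fun a ha => h a (by simp [ha])
    rw [del_append, ← List.cons_append, proj_append, ih, ← List.cons_append, proj_append]
    rcases (h c (by simp)).eq_or_lt with rfl | hlt
    · rw [del_cons_of_mem (by simp), proj_cons i w,
        proj_cancel_right i w fun a ha => h a (by simp [ha])]
      exact mul_one _
    · rw [del_cons_of_notMem (by simpa using hlt)]
      rfl

theorem vertexWord_eq_canOn {n : ℕ} (i : Fin n) (w : Word n) :
    vertexWord i w = canOn (Finset.Ici i) (trunc {i} w) := by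
  unfold canOn
  by_cases hw : i ∈ w
  · obtain ⟨x, y, rfl, hx⟩ := exists_first hw
    rw [vertexWord_append_cons hx, trunc_append (by rintro a ha h; simp at h; exact hx (h ▸ ha)),
      trunc_cons_of_mem (by simp), del_cons_of_notMem (by simp)]
    obtain ⟨hp, hc⟩ := can_spec (del (Finset.Iic i) y)
    have hlt : ∀ a ∈ can (del (Finset.Iic i) y), i < a := fun a ha => by
      simpa using (mem_del.1 ((mem_iff_of_proj_eq hp a).1 ha)).2
    refine (IsCanonical.can_eq ?_ ?_).symm
    · refine isCanonical_of_special fun p u q a h => ?_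
      rcases p with _ | ⟨p', p⟩ <;> simp only [List.nil_append, List.cons_append,
        List.cons.injEq] at h
      · obtain ⟨rfl, h⟩ := h
        exact absurd (hlt i (by simp [h])) (lt_irrefl i)
      · exact hc.special h.2
    · rw [proj_cons i (can _), hp, ← proj_cons, ← proj_cons_del]
      · rw [del_del_of_subset]
        intro a
        simpa using le_of_lt
      · intro a ha
        simpa using (mem_del.1 ha).2
  · rw [vertexWord_of_notMem hw, trunc_eq_nil (by rintro a ha h; simp at h; exact hw (h ▸ ha))]
    exact (isCanonical_nil.can_eq rfl).symm

theorem exists_trunc_singleton_eq {n : ℕ} (k : Fin n) (w : Word n) :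
    ∃ j ≤ k, trunc (Finset.Iic k) w = trunc {j} w := by
  rcases notMem_or_exists_first (Finset.Iic k) w with h | ⟨x, a, y, rfl, hx, ha⟩
  · refine ⟨k, le_rfl, ?_⟩
    rw [trunc_eq_nil h, trunc_eq_nil]
    intro a haw hak
    exact h a haw (by simp_all)
  · refine ⟨a, by simpa using ha, ?_⟩
    rw [trunc_append hx, trunc_cons_of_mem ha, trunc_append, trunc_cons_of_mem (by simp)]
    intro b hb hba
    obtain rfl : b = a := by simpa using hba
    exact hx b hb ha

end Kiselman

theorem mainTheorem2 (n : ℕ) (w : Kiselman.Word n) :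
    (∃! v : Kiselman.Word n, Kiselman.proj v = Kiselman.proj w ∧ Kiselman.IsCanonical v) ∧
    (∀ i : Fin n, Kiselman.stateAt w i =
      Kiselman.canOn (Finset.Ici i) (Kiselman.trunc {i} w)) ∧
    (∀ k : Fin n, ∃ j : Fin n, j ≤ k ∧
      Kiselman.iterJoin
          (((List.finRange n).filter fun i => i ≤ k).map fun i => Kiselman.stateAt w i) =
        Kiselman.trunc (Finset.Iic k) (Kiselman.can w) ∧
      Kiselman.trunc (Finset.Iic k) (Kiselman.can w) =
        Kiselman.trunc {j} (Kiselman.can w)) := by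
  obtain ⟨hp, hc⟩ := Kiselman.can_spec w
  refine ⟨⟨Kiselman.can w, ⟨hp, hc⟩, fun v hv => (hv.2.can_eq hv.1.symm).symm⟩, fun i => ?_,
    fun k => ?_⟩
  · rw [Kiselman.stateAt_eq_vertexWord, Kiselman.vertexWord_eq_canOn]
  · obtain ⟨j, hj, heq⟩ := Kiselman.exists_trunc_singleton_eq k (Kiselman.can w)
    refine ⟨j, hj, ?_, heq⟩
    -- The vertex words are class invariants, so those of `w` may be replaced by those of its
    -- canonical form, to which the reconstruction applies.
    simp only [Kiselman.stateAt_eq_vertexWord,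
      ← Kiselman.vertexWord_congr (Kiselman.tail_invariants hp _).2]
    rw [hc.iterJoin_vertexWord (fun a _ => Kiselman.uniqueAbove a)]
    · congr 1
      ext i
      simp
    · exact (List.pairwise_lt_finRange n).filter _
    · intro i hi j hj
      simp only [List.mem_filter, List.mem_finRange, decide_eq_true_eq, true_and] at hi ⊢
      exact hj.le.trans hi
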